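/- Let $\mathbb D=\{\zeta\in\mathbb C:|\zeta|<1\}$ and let $D\subset\mathbb C^n$ be a bounded convex domain. A holomorphic map $f:\mathbb D\to D$ is called a complex geodesic if it has a left inverse, that is, a holomorphic function $G:D\to\mathbb D$ with $G(f(\zeta))=\zeta$ for all $\zeta\in\mathbb D$. A left inverse $G$ of $f$ is called a Lempert left inverse if for every $\zeta\in\mathbb D$ the fibre $G^{-1}(\zeta)$ is the intersection of $D$ with a complex affine hyperplane. Let $f:\mathbb D\to D$ be a complex geodesic and let $G_0,G_1$ be two left inverses of $f$. Then there is a one-parameter family $H_t:D\to\mathbb D$, $t\in[0,1]$, of Lempert left inverses of $f$ such that $(t,z)\mapsto H_t(z)$ is continuous on $[0,1]\times D$ and such that, for $j=0,1$, $H_j$ is the left inverse corresponding to $G_j$ in the following sense: for every $z\in D$, $\zeta=H_j(z)$ is the one and only $\zeta\in\mathbb D$ with $$G_j'(f(\zeta))\bullet(z-f(\zeta))=0,\qquad\text{where } w\bullet v:=\sum_{k=1}^n w_kv_k .$$ In particular, any two Lempert left inverses $L_0,L_1$ of $f$ are homotopic through Lempert left inverses: there is a family $H_t:D\to\mathbb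 D$, $t\in[0,1]$, of Lempert left inverses of $f$, with $(t,z)\mapsto H_t(z)$ continuous on $[0,1]\times D$, such that $H_0=L_0$ and $H_1=L_1$ on $D$. -/

import Mathlib

/-- `G` is a (holomorphic) left inverse, `D → 𝔻`, of the map `f : 𝔻 → D`:
`G (f ζ) = ζ` for all `ζ` in the open unit disc `𝔻`. Only the values of `f` on `𝔻` and of `G` on
the domain `D` matter. -/
def IsHolLeftInverse {n : ℕ} (D : Set (EuclideanSpace ℂ (Fin n)))
    (f : ℂ → EuclideanSpace ℂ (Fin n)) (G : EuclideanSpace ℂ (Fin n) → ℂ) : Prop :=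
  DifferentiableOn ℂ G D ∧ Set.MapsTo G D (Metric.ball (0 : ℂ) 1) ∧
    ∀ ζ ∈ Metric.ball (0 : ℂ) 1, G (f ζ) = ζ

/-- `f : 𝔻 → D` is a complex geodesic: a holomorphic map that has a holomorphic left inverse. -/
def IsComplexGeodesic {n : ℕ} (D : Set (EuclideanSpace ℂ (Fin n)))
    (f : ℂ → EuclideanSpace ℂ (Fin n)) : Prop :=
  DifferentiableOn ℂ f (Metric.ball (0 : ℂ) 1) ∧ Set.MapsTo f (Metric.ball (0 : ℂ) 1) D ∧
    ∃ G : EuclideanSpace ℂ (Fin n) → ℂ, IsHolLeftInverse D f G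

/-- A complex affine hyperplane of `ℂⁿ`: a level set of a nonzero `ℂ`-linear functional. -/
def IsAffineHyperplane {n : ℕ} (A : Set (EuclideanSpace ℂ (Fin n))) : Prop :=
  ∃ (l : EuclideanSpace ℂ (Fin n) →L[ℂ] ℂ) (c : ℂ), l ≠ 0 ∧ A = {z | l z = c}

/-- `G` is a Lempert left inverse of `f`: a left inverse each of whose fibres over a point of `𝔻`
is the intersection of `D` with a complex affine hyperplane. -/
def IsLempertLeftInverse {n : ℕ} (D : Set (EuclideanSpace ℂ (Fin n)))
    (f : ℂ → EuclideanSpace ℂ (Fin n)) (G : EuclideanSpace ℂ (Fin n) → ℂ) : Prop :=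
  IsHolLeftInverse D f G ∧
    ∀ ζ ∈ Metric.ball (0 : ℂ) 1, ∃ A : Set (EuclideanSpace ℂ (Fin n)),
      IsAffineHyperplane A ∧ {z ∈ D | G z = ζ} = A ∩ D

/-- `H` corresponds to the left inverse `G` of `f`: for each `z ∈ D` the value `H z` is the one and
only `ζ ∈ 𝔻` with `G'(f ζ) • (z - f ζ) = 0`, where `w • v = ∑ j, w j * v j`, so that the left-hand
side is the complex derivative of `G` at `f ζ` applied to `z - f ζ`. -/
def CorrespondsTo {n : ℕ} (D : Set (EuclideanSpace ℂ (Fin n)))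
    (f : ℂ → EuclideanSpace ℂ (Fin n)) (G H : EuclideanSpace ℂ (Fin n) → ℂ) : Prop :=
  ∀ z ∈ D, H z ∈ Metric.ball (0 : ℂ) 1 ∧
    ∀ ζ ∈ Metric.ball (0 : ℂ) 1, fderiv ℂ G (f ζ) (z - f ζ) = 0 ↔ ζ = H z

/-- `(H t)`, `t ∈ [0, 1]`, is a homotopy through Lempert left inverses of `f`: every `H t` is a
Lempert left inverse and `(t, z) ↦ H t z` is continuous on `[0, 1] × D`. -/
def IsLempertHomotopy {n : ℕ} (D : Set (EuclideanSpace ℂ (Fin n)))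
    (f : ℂ → EuclideanSpace ℂ (Fin n)) (H : ℝ → EuclideanSpace ℂ (Fin n) → ℂ) : Prop :=
  (∀ t ∈ Set.Icc (0 : ℝ) 1, IsLempertLeftInverse D f (H t)) ∧
    ContinuousOn (fun p : ℝ × EuclideanSpace ℂ (Fin n) => H p.1 p.2) (Set.Icc (0 : ℝ) 1 ×ˢ D)

section LempertInverses

open Metric Set Filter Topology ComplexConjugate

/-! Fix `z ∈ D` and a left inverse `G`, and put `φ ζ = G'(f ζ) • (z - f ζ)`. By convexity `f + s (z
- f)` stays in `D`, so `G` along it is a self-map of the disc of the form `ζ + s φ ζ + o(s)`.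
Schwarz-Pick, to first order in `s`, gives `Re φ' (1 - |ζ|²) + 2 Re (conj ζ φ) ≤ 0`
(`generator_inequality`). Since `D` is open and bounded, `z` can be perturbed a little, which
improves the right side to `-δ (1 - |ζ|²)` with `δ > 0` (`IsHolLeftInverse.isContractingField`).
Such a field has exactly one zero in the disc, and it is simple (`exists_zero`, `eq_of_zero`,
`deriv_ne_zero`). The inequality is real-linear in `φ`, so it survives the combination `(1 - t) φ₀ +
t φ₁` of the fields of two left inverses (`convex_comb`). `H t z` is the zero of this combination;
the implicit function theorem makes it holomorphic in `z` and continuous in `(t, z)`. For fixed `ζ`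
the equation is affine in `z`, so the fibres are slices of hyperplanes. -/

/-! ### Difference quotients of bounded holomorphic functions. -/

theorem norm_slope_sub_deriv_le {k : ℂ → ℂ} {ρ : ℝ} (hρ : 0 < ρ)
    (hk : DifferentiableOn ℂ k (ball 0 ρ)) (hb : ∀ ξ ∈ ball (0 : ℂ) ρ, ‖k ξ‖ < 1)
    {ξ : ℂ} (hξ : ξ ∈ ball (0 : ℂ) ρ) (hξ0 : ξ ≠ 0) :
    ‖ξ⁻¹ * (k ξ - k 0) - deriv k 0‖ ≤ 5 / ρ / ρ * ‖ξ‖ := by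
  have h0 : (0 : ℂ) ∈ ball (0 : ℂ) ρ := mem_ball_self hρ
  have hmaps : MapsTo k (ball 0 ρ) (closedBall (k 0) 2) := fun x hx => by
    rw [mem_closedBall, dist_eq_norm]
    linarith [norm_sub_le (k x) (k 0), hb x hx, hb 0 h0]
  have hK : DifferentiableOn ℂ (dslope k 0) (ball 0 ρ) :=
    (Complex.differentiableOn_dslope (ball_mem_nhds _ hρ)).2 hk
  have hKb : ∀ x ∈ ball (0 : ℂ) ρ, ‖dslope k 0 x‖ ≤ 2 / ρ := fun x hx =>
    Complex.norm_dslope_le_div_of_mapsTo_ball hk hmaps hx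
  -- The Schwarz bound `2 / ρ` on the slope is used at `x` and at `0`, giving `4 / ρ`; the 5 is
  -- slack. A second Schwarz estimate, for the slope itself, yields the linear rate.
  have hKm : MapsTo (dslope k 0) (ball 0 ρ) (closedBall (dslope k 0 0) (5 / ρ)) := fun x hx => by
    rw [mem_closedBall, dist_eq_norm]
    refine (norm_sub_le _ _).trans ((add_le_add (hKb x hx) (hKb 0 h0)).trans ?_)
    rw [← add_div]
    gcongr
    norm_num
  have := Complex.dist_le_div_mul_dist_of_mapsTo_ball hK hKm hξ
  rw [dslope_same, dslope_of_ne _ hξ0, slope_def_module, dist_eq_norm, dist_zero_right] at this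
  simpa using this

/-- Difference quotients of a bounded holomorphic function along a holomorphic family of
directions converge uniformly near each point. -/
theorem exists_tendstoUniformlyOn_slope {E : Type*} [NormedAddCommGroup E] [NormedSpace ℂ E]
    {D : Set E} (hD : IsOpen D) {G : E → ℂ} (hG : DifferentiableOn ℂ G D)
    (hGb : MapsTo G D (ball 0 1)) {f v : ℂ → E} {U : Set ℂ} (hU : IsOpen U)
    (hf : DifferentiableOn ℂ f U) (hfD : MapsTo f U D) (hv : DifferentiableOn ℂ v U)
    {z : ℂ} (hz : z ∈ U) :
    ∃ V, IsOpen V ∧ z ∈ V ∧ V ⊆ U ∧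
      (∀ᶠ ξ in 𝓝[≠] (0 : ℂ), DifferentiableOn ℂ
        (fun x => ξ⁻¹ * (G (f x + ξ • v x) - G (f x))) V) ∧
      TendstoUniformlyOn (fun ξ x => ξ⁻¹ * (G (f x + ξ • v x) - G (f x)))
        (fun x => fderiv ℂ G (f x) (v x)) (𝓝[≠] (0 : ℂ)) V := by
  have hcf : ContinuousAt f z := (hf.differentiableAt (hU.mem_nhds hz)).continuousAt
  have hcv : ContinuousAt v z := (hv.differentiableAt (hU.mem_nhds hz)).continuousAt
  have hc : ContinuousAt (fun p : ℂ × ℂ => f p.2 + p.1 • v p.2) ((0 : ℂ), z) := by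
    have h1 : ContinuousAt (fun p : ℂ × ℂ => f p.2) ((0 : ℂ), z) :=
      ContinuousAt.comp (x := ((0 : ℂ), z)) (g := f) hcf continuousAt_snd
    have h2 : ContinuousAt (fun p : ℂ × ℂ => v p.2) ((0 : ℂ), z) :=
      ContinuousAt.comp (x := ((0 : ℂ), z)) (g := v) hcv continuousAt_snd
    exact h1.add (continuousAt_fst.smul h2)
  have hev : ∀ᶠ p : ℂ × ℂ in 𝓝 ((0 : ℂ), z), f p.2 + p.1 • v p.2 ∈ D :=
    hc.eventually_mem (hD.mem_nhds (by simpa using hfD hz))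
  rw [nhds_prod_eq] at hev
  obtain ⟨p, hp, q, hq, hpq⟩ := Filter.eventually_prod_iff.1 hev
  obtain ⟨ρ, hρ, hρp⟩ := Metric.eventually_nhds_iff_ball.1 hp
  obtain ⟨η, hη, hηq⟩ := Metric.eventually_nhds_iff_ball.1 (hq.and (hU.mem_nhds hz))
  have hmem : ∀ ξ ∈ ball (0 : ℂ) ρ, ∀ x ∈ ball z η, f x + ξ • v x ∈ D := fun ξ hξ x hx =>
    hpq (hρp ξ hξ) (hηq x hx).1
  have hsub : ball z η ⊆ U := fun x hx => (hηq x hx).2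
  have hsmall : ∀ᶠ ξ in 𝓝[≠] (0 : ℂ), ξ ∈ ball (0 : ℂ) ρ :=
    mem_nhdsWithin_of_mem_nhds (ball_mem_nhds _ hρ)
  refine ⟨ball z η, isOpen_ball, mem_ball_self hη, hsub, ?_, ?_⟩
  · filter_upwards [hsmall] with ξ hξ
    refine ((hG.comp ((hf.mono hsub).add ((hv.mono hsub).const_smul ξ))
      fun x hx => hmem ξ hξ x hx).sub (hG.comp (hf.mono hsub) fun x hx => hfD (hsub hx))).const_mul _
  · rw [Metric.tendstoUniformlyOn_iff]
    intro ε hε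
    have hlim : Tendsto (fun ξ : ℂ => 5 / ρ / ρ * ‖ξ‖) (𝓝[≠] 0) (𝓝 0) := by
      have : Continuous (fun ξ : ℂ => 5 / ρ / ρ * ‖ξ‖) := by fun_prop
      simpa using this.tendsto 0 |>.mono_left nhdsWithin_le_nhds
    filter_upwards [hsmall, self_mem_nhdsWithin, hlim.eventually_lt_const hε] with ξ hξ hξ0 hlt x hx
    have hk : DifferentiableOn ℂ (fun t : ℂ => G (f x + t • v x)) (ball 0 ρ) :=
      hG.comp (by fun_prop) fun t ht => hmem t ht x hx
    have hd : deriv (fun t : ℂ => G (f x + t • v x)) 0 = fderiv ℂ G (f x) (v x) := by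
      have h1 : HasFDerivAt G (fderiv ℂ G (f x)) (f x + (0 : ℂ) • v x) := by
        rw [zero_smul, add_zero]
        exact (hG.differentiableAt (hD.mem_nhds (hfD (hsub hx)))).hasFDerivAt
      have h2 : HasDerivAt (fun t : ℂ => f x + t • v x) (v x) 0 := by
        simpa using ((hasDerivAt_id (0 : ℂ)).smul_const (v x)).const_add (f x)
      exact (h1.comp_hasDerivAt (0 : ℂ) h2).deriv
    have := norm_slope_sub_deriv_le hρ hk (fun t ht => by
      simpa using hGb (hmem t ht x hx)) hξ hξ0
    rw [hd] at this
    rw [dist_comm, dist_eq_norm]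
    simp only [zero_smul, add_zero] at this
    exact this.trans_lt hlt

theorem differentiableOn_fderiv_apply {E : Type*} [NormedAddCommGroup E] [NormedSpace ℂ E]
    {D : Set E} (hD : IsOpen D) {G : E → ℂ} (hG : DifferentiableOn ℂ G D)
    (hGb : MapsTo G D (ball 0 1)) {f v : ℂ → E} {U : Set ℂ} (hU : IsOpen U)
    (hf : DifferentiableOn ℂ f U) (hfD : MapsTo f U D) (hv : DifferentiableOn ℂ v U) :
    DifferentiableOn ℂ (fun x => fderiv ℂ G (f x) (v x)) U := by
  intro z hz
  obtain ⟨V, hV, hzV, -, hd, hlim⟩ := exists_tendstoUniformlyOn_slope hD hG hGb hU hf hfD hv hz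
  exact ((hlim.tendstoLocallyUniformlyOn.differentiableOn hd hV).differentiableAt
    (hV.mem_nhds hzV)).differentiableWithinAt

/-! ### Möbius maps and the Schwarz-Pick lemma. -/

/-- The Möbius map of the disc taking `0` to `a`. -/
noncomputable def discShift (a z : ℂ) : ℂ := (z + a) / (1 + conj a * z)

theorem one_add_conj_mul_ne_zero {a z : ℂ} (ha : ‖a‖ < 1) (hz : ‖z‖ < 1) :
    1 + conj a * z ≠ 0 := by
  intro h
  have h1 : ‖conj a * z‖ = 1 := by
    rw [show conj a * z = -1 by linear_combination h]; simp
  rw [norm_mul, RCLike.norm_conj] at h1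
  nlinarith [norm_nonneg a, norm_nonneg z]

theorem normSq_one_add_conj_mul_sub (a z : ℂ) :
    Complex.normSq (1 + conj a * z) - Complex.normSq (z + a)
      = (1 - Complex.normSq a) * (1 - Complex.normSq z) := by
  simp [Complex.normSq_apply]; ring

theorem one_sub_norm_discShift_sq {a z : ℂ} (ha : ‖a‖ < 1) (hz : ‖z‖ < 1) :
    1 - ‖discShift a z‖ ^ 2 = (1 - ‖a‖ ^ 2) * (1 - ‖z‖ ^ 2) / ‖1 + conj a * z‖ ^ 2 := by
  have h := normSq_one_add_conj_mul_sub a z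
  have h0 : ‖1 + conj a * z‖ ≠ 0 := norm_ne_zero_iff.2 (one_add_conj_mul_ne_zero ha hz)
  simp only [Complex.normSq_eq_norm_sq] at h
  rw [← h, discShift, norm_div, div_pow, eq_div_iff (pow_ne_zero 2 h0), sub_mul,
    div_mul_cancel₀ _ (pow_ne_zero 2 h0), one_mul]

theorem norm_discShift_lt {a z : ℂ} (ha : ‖a‖ < 1) (hz : ‖z‖ < 1) : ‖discShift a z‖ < 1 := by
  have h := one_sub_norm_discShift_sq ha hz
  have h0 : 0 < ‖1 + conj a * z‖ := norm_pos_iff.2 (one_add_conj_mul_ne_zero ha hz)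
  have : 0 < (1 - ‖a‖ ^ 2) * (1 - ‖z‖ ^ 2) / ‖1 + conj a * z‖ ^ 2 := by
    have := norm_nonneg a
    have := norm_nonneg z
    have : 0 < 1 - ‖a‖ ^ 2 := by nlinarith
    have : 0 < 1 - ‖z‖ ^ 2 := by nlinarith
    positivity
  nlinarith [norm_nonneg (discShift a z)]

theorem hasDerivAt_discShift {a z : ℂ} (ha : ‖a‖ < 1) (hz : ‖z‖ < 1) :
    HasDerivAt (discShift a) ((1 - conj a * a) / (1 + conj a * z) ^ 2) z := by
  have h0 := one_add_conj_mul_ne_zero ha hz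
  have h := ((hasDerivAt_id z).add_const a).div
    (((hasDerivAt_id z).const_mul (conj a)).const_add 1) h0
  refine h.congr_deriv ?_
  simp only [id]; ring

theorem discShift_neg_discShift {a z : ℂ} (ha : ‖a‖ < 1) (hz : ‖z‖ < 1) :
    discShift a (discShift (-a) z) = z := by
  have h0 : 1 - conj a * z ≠ 0 := by
    simpa [sub_eq_add_neg] using one_add_conj_mul_ne_zero (a := -a) (by simpa using ha) hz
  have h1 : 1 + conj a * discShift (-a) z ≠ 0 :=
    one_add_conj_mul_ne_zero ha (norm_discShift_lt (by simpa using ha) hz)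
  rw [discShift, div_eq_iff h1, discShift, map_neg, neg_mul, ← sub_eq_add_neg, ← sub_eq_add_neg]
  linear_combination div_mul_cancel₀ (z - a) h0

/-- The infinitesimal form of the Schwarz-Pick lemma. -/
theorem norm_deriv_mul_le_one_sub_sq {g : ℂ → ℂ} (hg : DifferentiableOn ℂ g (ball 0 1))
    (hm : MapsTo g (ball 0 1) (ball 0 1)) {z : ℂ} (hz : z ∈ ball (0 : ℂ) 1) :
    ‖deriv g z‖ * (1 - ‖z‖ ^ 2) ≤ 1 - ‖g z‖ ^ 2 := by
  have hz' : ‖z‖ < 1 := by simpa using hz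
  have hb : ‖g z‖ < 1 := by simpa using hm hz
  have hb' : ‖-g z‖ < 1 := by simpa using hb
  -- Möbius maps on both sides move `z` and `g z` to the origin, which reduces the claim to the
  -- Schwarz lemma at `0`.
  set h : ℂ → ℂ := fun w => discShift (-g z) (g (discShift z w)) with hh
  have hS : discShift z 0 = z := by simp [discShift]
  have hmaps : MapsTo (discShift z) (ball 0 1) (ball 0 1) := fun w hw => by
    simpa using norm_discShift_lt hz' (by simpa using hw)
  have hdiff : DifferentiableOn ℂ h (ball 0 1) := by
    have h1 : DifferentiableOn ℂ (discShift z) (ball 0 1) := fun w hw =>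
      (hasDerivAt_discShift hz' (by simpa using hw)).differentiableAt.differentiableWithinAt
    have h2 : DifferentiableOn ℂ (discShift (-g z)) (ball 0 1) := fun w hw =>
      (hasDerivAt_discShift hb' (by simpa using hw)).differentiableAt.differentiableWithinAt
    exact h2.comp (hg.comp h1 hmaps) (hm.comp hmaps)
  have h00 : h 0 = 0 := by simp [hh, discShift]
  have hhm : MapsTo h (ball 0 1) (closedBall (h 0) 1) := fun w hw => by
    rw [h00]
    have : ‖h w‖ < 1 := norm_discShift_lt hb' (by simpa using hm (hmaps hw))
    simpa using this.le
  have hle := Complex.norm_deriv_le_one_of_mapsTo_ball hdiff hhm one_pos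
  have hd1 : HasDerivAt (discShift z) (1 - conj z * z) 0 := by
    simpa using hasDerivAt_discShift hz' (z := 0) (by simp)
  have hd2 : HasDerivAt g (deriv g z) (discShift z 0) := by
    rw [hS]; exact (hg.differentiableAt (isOpen_ball.mem_nhds hz)).hasDerivAt
  have hd3 := hasDerivAt_discShift hb' (z := g z) hb
  have hd3' : HasDerivAt (discShift (-g z))
      ((1 - conj (-g z) * -g z) / (1 + conj (-g z) * g z) ^ 2) (g (discShift z 0)) := by
    rw [hS]; exact hd3
  have hd : HasDerivAt h ((1 - conj (-g z) * -g z) / (1 + conj (-g z) * g z) ^ 2 *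
      (deriv g z * (1 - conj z * z))) 0 :=
    HasDerivAt.comp (h := fun w => g (discShift z w)) (0 : ℂ) hd3' (hd2.comp (0 : ℂ) hd1)
  rw [hd.deriv] at hle
  have e1 : ∀ w : ℂ, 1 - conj w * w = ((1 - ‖w‖ ^ 2 : ℝ) : ℂ) := fun w => by
    rw [Complex.conj_mul']; push_cast; ring
  have e2 : (1 - conj (-g z) * -g z) / (1 + conj (-g z) * g z) ^ 2
      = (((1 - ‖g z‖ ^ 2)⁻¹ : ℝ) : ℂ) := by
    have : (1 + conj (-g z) * g z) = ((1 - ‖g z‖ ^ 2 : ℝ) : ℂ) := by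
      rw [← e1]; simp; ring
    rw [this, e1]
    push_cast
    rw [norm_neg]
    have : (1 - (‖g z‖ : ℂ) ^ 2) ≠ 0 := by
      have : (1 - ‖g z‖ ^ 2 : ℝ) ≠ 0 := by nlinarith [norm_nonneg (g z)]
      exact_mod_cast this
    field_simp
  have p1 : 0 < 1 - ‖g z‖ ^ 2 := by nlinarith [norm_nonneg (g z)]
  have p2 : 0 < 1 - ‖z‖ ^ 2 := by nlinarith [norm_nonneg z]
  rw [e2, e1, norm_mul, norm_mul, Complex.norm_real, Complex.norm_real, Real.norm_of_nonneg p2.le,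
    Real.norm_of_nonneg (inv_nonneg.2 p1.le), inv_mul_le_iff₀ p1] at hle
  simpa using hle

/-! ### Contracting fields: existence, uniqueness and simplicity of the zero. -/

/-- A holomorphic vector field on the unit disc whose flow contracts the hyperbolic metric at
rate at least `δ`. -/
def IsContractingField (δ : ℝ) (φ : ℂ → ℂ) : Prop :=
  DifferentiableOn ℂ φ (ball 0 1) ∧ ∀ z ∈ ball (0 : ℂ) 1,
    (deriv φ z).re * (1 - ‖z‖ ^ 2) + 2 * (conj z * φ z).re ≤ -δ * (1 - ‖z‖ ^ 2)

namespace IsContractingField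

theorem one_sub_sq_pos {z : ℂ} (hz : z ∈ ball (0 : ℂ) 1) : 0 < 1 - ‖z‖ ^ 2 := by
  have : ‖z‖ < 1 := by simpa using hz
  nlinarith [norm_nonneg z]

variable {δ : ℝ} {φ : ℂ → ℂ}

/-- Along a ray, the contraction inequality says that the derivative of `Re (conj e φ(x e)) / (1 -
x²)` is at most `-δ / (1 - x²)`. Since `1 + x ≤ 2`, this is at most `-δ / (2 (1 - x))`, the
derivative of the logarithmic term. -/
theorem radial_le (h : IsContractingField δ φ) (hδ : 0 ≤ δ) {e : ℂ} (he : ‖e‖ = 1) {r : ℝ}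
    (hr : r ∈ Ico (0 : ℝ) 1) :
    (conj e * φ (r * e)).re / (1 - r ^ 2) ≤ (conj e * φ 0).re + δ / 2 * Real.log (1 - r) := by
  set W : ℝ → ℝ := fun x => (conj e * φ (x * e)).re / (1 - x ^ 2) - δ / 2 * Real.log (1 - x)
    with hW
  have hee : conj e * e = 1 := by rw [Complex.conj_mul', he]; simp
  have key : ∀ x ∈ Ico (0 : ℝ) 1, ∃ d ≤ 0, HasDerivAt W d x := by
    intro x hx
    have hn : ‖(x : ℂ) * e‖ = x := by simp [he, abs_of_nonneg hx.1]
    have hmem : (x : ℂ) * e ∈ ball (0 : ℂ) 1 := by simpa [he, abs_of_nonneg hx.1] using hx.2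
    have hin := h.2 _ hmem
    have hd : HasDerivAt φ (deriv φ (x * e)) ((x : ℂ) * e) :=
      (h.1.differentiableAt (isOpen_ball.mem_nhds hmem)).hasDerivAt
    have h1 : HasDerivAt (fun w : ℂ => conj e * φ (w * e)) (deriv φ (x * e)) (x : ℂ) := by
      refine ((hd.comp (x : ℂ) ((hasDerivAt_id (x : ℂ)).mul_const e)).const_mul
        (conj e)).congr_deriv ?_
      linear_combination deriv φ (x * e) * hee
    have h2 := h1.real_of_complex
    have p1 : 0 < 1 - x := by linarith [hx.2]
    have p2 : 0 < 1 - x ^ 2 := by nlinarith [hx.1, hx.2]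
    have h3 : HasDerivAt (fun y : ℝ => 1 - y ^ 2) (-(2 * x)) x := by
      simpa using (hasDerivAt_pow 2 x).const_sub 1
    have h4 : HasDerivAt (fun y : ℝ => Real.log (1 - y)) (-1 / (1 - x)) x :=
      ((hasDerivAt_id x).const_sub 1).log p1.ne'
    refine ⟨_, ?_, (h2.div h3 p2.ne').sub (h4.const_mul (δ / 2))⟩
    rw [hn] at hin
    have e1 : (conj ((x : ℂ) * e) * φ (x * e)).re = x * (conj e * φ (x * e)).re := by
      rw [map_mul, Complex.conj_ofReal, mul_assoc, Complex.re_ofReal_mul]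
    rw [e1] at hin
    have e2 : (deriv φ (x * e)).re * (1 - x ^ 2) - (conj e * φ (x * e)).re * -(2 * x)
        ≤ -δ * (1 - x ^ 2) := by linarith
    have e3 : ((deriv φ (x * e)).re * (1 - x ^ 2) - (conj e * φ (x * e)).re * -(2 * x)) /
        (1 - x ^ 2) ^ 2 ≤ -δ / (1 - x ^ 2) := by
      rw [div_le_div_iff₀ (by positivity) p2]
      nlinarith
    have e4 : -δ / (1 - x ^ 2) - δ / 2 * (-1 / (1 - x)) ≤ 0 := by
      have : -δ / (1 - x ^ 2) - δ / 2 * (-1 / (1 - x)) = -(δ / 2 * (1 - x) / (1 - x ^ 2)) := by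
        have : 1 + x ≠ 0 := by linarith [hx.1]
        have : 1 - x ^ 2 = (1 - x) * (1 + x) := by ring
        rw [this]
        field_simp
        ring
      rw [this]
      have : 0 ≤ δ / 2 * (1 - x) / (1 - x ^ 2) := by positivity
      linarith
    linarith
  have hanti : AntitoneOn W (Ico 0 1) := by
    refine antitoneOn_of_deriv_nonpos (convex_Ico 0 1) (fun x hx => ?_) (fun x hx => ?_)
      fun x hx => ?_
    · obtain ⟨d, -, hd⟩ := key x hx
      exact hd.continuousAt.continuousWithinAt
    · obtain ⟨d, -, hd⟩ := key x (interior_subset hx)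
      exact hd.differentiableAt.differentiableWithinAt
    · obtain ⟨d, hd0, hd⟩ := key x (interior_subset hx)
      rwa [hd.deriv]
  have := hanti (left_mem_Ico.2 one_pos) hr hr.1
  simp only [hW, Complex.ofReal_zero, zero_mul, zero_pow two_ne_zero, sub_zero, div_one,
    Real.log_one, mul_zero] at this
  linarith

/-- The logarithm in `radial_le` forces the field to point inwards on a circle close to the
boundary. Without a zero, `z / φ z` would be holomorphic with negative real part on that circle but
value `0` at the centre, against the maximum principle. -/
theorem exists_zero (h : IsContractingField δ φ) (hδ : 0 < δ) :
    ∃ z ∈ ball (0 : ℂ) 1, φ z = 0 := by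
  by_contra! hne
  -- The radius makes the logarithmic term equal to `-‖φ 0‖ - δ / 2`, which outweighs `Re (conj e φ
  -- 0) ≤ ‖φ 0‖`.
  set r : ℝ := 1 - Real.exp (-(2 * ‖φ 0‖ / δ + 1)) with hr
  have hrlt : r < 1 := by linarith [Real.exp_pos (-(2 * ‖φ 0‖ / δ + 1))]
  have hrpos : 0 < r := by
    have : Real.exp (-(2 * ‖φ 0‖ / δ + 1)) < 1 := by
      rw [Real.exp_lt_one_iff]
      have : 0 ≤ 2 * ‖φ 0‖ / δ := by positivity
      linarith
    linarith
  have hlog : δ / 2 * Real.log (1 - r) = -‖φ 0‖ - δ / 2 := by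
    rw [hr, sub_sub_cancel, Real.log_exp]; field_simp; ring
  have hneg : ∀ z : ℂ, ‖z‖ = r → (conj z * φ z).re < 0 := by
    intro z hz
    have he : ‖((r⁻¹ : ℝ) : ℂ) * z‖ = 1 := by
      rw [norm_mul, Complex.norm_real, Real.norm_of_nonneg (inv_nonneg.2 hrpos.le), hz,
        inv_mul_cancel₀ hrpos.ne']
    have h1 := h.radial_le hδ.le he ⟨hrpos.le, hrlt⟩
    have h2 : (r : ℂ) * (((r⁻¹ : ℝ) : ℂ) * z) = z := by
      rw [← mul_assoc, ← Complex.ofReal_mul, mul_inv_cancel₀ hrpos.ne']; simp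
    rw [h2, hlog] at h1
    have h3 : (conj (((r⁻¹ : ℝ) : ℂ) * z) * φ 0).re ≤ ‖φ 0‖ := by
      refine (Complex.re_le_norm _).trans ?_
      rw [norm_mul, RCLike.norm_conj, he, one_mul]
    have h4 : (conj (((r⁻¹ : ℝ) : ℂ) * z) * φ z).re = r⁻¹ * (conj z * φ z).re := by
      rw [map_mul, Complex.conj_ofReal, mul_assoc, Complex.re_ofReal_mul]
    have p : 0 < 1 - r ^ 2 := by nlinarith
    have h5 : r⁻¹ * (conj z * φ z).re / (1 - r ^ 2) < 0 := by rw [← h4]; linarith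
    by_contra! hc
    have : 0 ≤ r⁻¹ * (conj z * φ z).re / (1 - r ^ 2) := by positivity
    linarith
  have hsub : closedBall (0 : ℂ) r ⊆ ball 0 1 := closedBall_subset_ball hrlt
  -- The exponential turns the real part into a modulus: it is `1` at the centre and less than `1`
  -- on the circle, as `Re (z / φ)` has the sign of `Re (conj z φ)`.
  have hdiff : DifferentiableOn ℂ (fun z => Complex.exp (z / φ z)) (closure (ball 0 r)) := by
    rw [closure_ball _ hrpos.ne']
    exact (differentiableOn_id.div (h.1.mono hsub) fun z hz => hne z (hsub hz)).cexp
  obtain ⟨z, hz, hmax⟩ := Complex.exists_mem_frontier_isMaxOn_norm isBounded_ball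
    (nonempty_ball.2 hrpos) hdiff.diffContOnCl
  rw [frontier_ball _ hrpos.ne', mem_sphere_zero_iff_norm] at hz
  have h0 := hmax (subset_closure (mem_ball_self hrpos))
  simp only [mem_ofPred_eq, Function.comp_apply, zero_div, Complex.norm_exp, Complex.zero_re,
    Real.exp_le_exp] at h0
  have h1 := hneg z hz
  have hz1 : z ∈ ball (0 : ℂ) 1 := hsub (by simp [hz])
  have hpos : 0 < Complex.normSq (φ z) := Complex.normSq_pos.2 (hne z hz1)
  rw [Complex.div_re, ← add_div, le_div_iff₀ hpos] at h0
  simp at h1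
  linarith

/-- This is the pullback `φ ∘ σ / σ'` of the field under the automorphism `σ = discShift a`. The
rate is preserved because `σ` is a hyperbolic isometry. It serves to move a zero to the origin. -/
theorem comp_discShift (h : IsContractingField δ φ) {a : ℂ} (ha : ‖a‖ < 1) :
    IsContractingField δ
      (fun w => φ (discShift a w) * (1 + conj a * w) ^ 2 / (1 - conj a * a)) := by
  have hP : (1 - conj a * a) = ((1 - ‖a‖ ^ 2 : ℝ) : ℂ) := by
    rw [Complex.conj_mul']; push_cast; ring
  have hP0 : 0 < 1 - ‖a‖ ^ 2 := by nlinarith [norm_nonneg a]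
  have hPc : (1 - conj a * a) ≠ 0 := by rw [hP]; exact_mod_cast hP0.ne'
  have hder : ∀ w ∈ ball (0 : ℂ) 1, HasDerivAt
      (fun w => φ (discShift a w) * (1 + conj a * w) ^ 2 / (1 - conj a * a))
      (deriv φ (discShift a w) +
        φ (discShift a w) * (2 * conj a * (1 + conj a * w)) / (1 - conj a * a)) w := by
    intro w hw
    have hw' : ‖w‖ < 1 := by simpa using hw
    have hm : discShift a w ∈ ball (0 : ℂ) 1 := by simpa using norm_discShift_lt ha hw'
    have h1 := (h.1.differentiableAt (isOpen_ball.mem_nhds hm)).hasDerivAt.comp w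
      (hasDerivAt_discShift ha hw')
    have h2 : HasDerivAt (fun w : ℂ => (1 + conj a * w) ^ 2)
        (2 * (1 + conj a * w) * conj a) w := by
      refine ((((hasDerivAt_id w).const_mul (conj a)).const_add 1).fun_pow 2).congr_deriv ?_
      simp
    refine ((h1.mul h2).div_const (1 - conj a * a)).congr_deriv ?_
    have := one_add_conj_mul_ne_zero ha hw'
    simp only [Function.comp_apply]
    field_simp
  refine ⟨fun w hw => (hder w hw).differentiableAt.differentiableWithinAt, fun w hw => ?_⟩
  have hw' : ‖w‖ < 1 := by simpa using hw
  have hm : discShift a w ∈ ball (0 : ℂ) 1 := by simpa using norm_discShift_lt ha hw'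
  have hin := h.2 _ hm
  rw [one_sub_norm_discShift_sq ha hw'] at hin
  rw [(hder w hw).deriv, hP]
  have hc0 := one_add_conj_mul_ne_zero ha hw'
  set c := 1 + conj a * w with hc
  set q := φ (discShift a w)
  set d := deriv φ (discShift a w)
  set P : ℝ := 1 - ‖a‖ ^ 2
  set S : ℝ := 1 - ‖w‖ ^ 2 with hS
  have hN : 0 < ‖c‖ ^ 2 := by have := norm_pos_iff.2 hc0; positivity
  have hSc : (S : ℂ) = 1 - conj w * w := by rw [Complex.conj_mul', hS]; push_cast; ring
  have e1 : (‖c‖ ^ 2 : ℝ) * (conj (discShift a w) * q).re = (conj (w + a) * c * q).re := by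
    rw [← Complex.re_ofReal_mul]
    congr 1
    have hcc : conj c ≠ 0 := (map_ne_zero _).2 hc0
    push_cast
    rw [← Complex.conj_mul', discShift, map_div₀, ← hc]
    field_simp
  have two_re : ∀ x : ℂ, (2 * x).re = 2 * x.re := fun x => by simp
  -- The terms without `φ'` combine: with `P S = ‖c‖² (1 - |σ w|²)`, they are the corresponding term
  -- at `σ w` scaled by `‖c‖² / P`.
  have e2 : (q * (2 * conj a * c) / (P : ℂ)).re * S + 2 * (conj w * (q * c ^ 2 / (P : ℂ))).re
      = 2 * (conj (w + a) * c * q).re / P := by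
    have t1 : (q * (2 * conj a * c) / (P : ℂ)).re * S
        = ((q * (2 * conj a * c) * S) / (P : ℂ)).re := by
      rw [← Complex.re_mul_ofReal]; congr 1; ring
    have t2 : 2 * (conj w * (q * c ^ 2 / (P : ℂ))).re
        = ((2 * (conj w * (q * c ^ 2))) / (P : ℂ)).re := by
      rw [show conj w * (q * c ^ 2 / (P : ℂ)) = (conj w * (q * c ^ 2)) / (P : ℂ) by ring,
        Complex.div_ofReal_re, Complex.div_ofReal_re, two_re]
      ring
    have t3 : 2 * (conj (w + a) * c * q).re / P = ((2 * (conj (w + a) * c * q)) / (P : ℂ)).re := by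
      rw [Complex.div_ofReal_re, two_re]
    rw [t1, t2, t3, ← Complex.add_re, ← add_div, hSc]
    congr 2
    rw [map_add, hc]
    ring
  have e3 : d.re * S + 2 * (conj (w + a) * c * q).re / P ≤ -δ * S := by
    rw [← e1]
    have := mul_le_mul_of_nonneg_right hin (by positivity : 0 ≤ ‖c‖ ^ 2 / P)
    have l1 : (d.re * (P * S / ‖c‖ ^ 2) + 2 * (conj (discShift a w) * q).re) * (‖c‖ ^ 2 / P)
        = d.re * S + 2 * (‖c‖ ^ 2 * (conj (discShift a w) * q).re) / P := by
      field_simp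
    have l2 : -δ * (P * S / ‖c‖ ^ 2) * (‖c‖ ^ 2 / P) = -δ * S := by field_simp
    rwa [l1, l2] at this
  rw [Complex.add_re, add_mul, add_assoc, e2]
  exact e3

/-- With `a` moved to the origin, `radial_le` at the second zero `w ≠ 0` would read `0 ≤ δ / 2 * log
(1 - ‖w‖)`, whose right side is negative. -/
theorem eq_of_zero (h : IsContractingField δ φ) (hδ : 0 < δ) {a b : ℂ}
    (ha : a ∈ ball (0 : ℂ) 1) (hb : b ∈ ball (0 : ℂ) 1) (hφa : φ a = 0) (hφb : φ b = 0) :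
    b = a := by
  have ha' : ‖a‖ < 1 := by simpa using ha
  have hb' : ‖b‖ < 1 := by simpa using hb
  have hψ := h.comp_discShift ha'
  set w := discShift (-a) b with hw
  have hwb : discShift a w = b := discShift_neg_discShift ha' hb'
  have hw1 : ‖w‖ < 1 := norm_discShift_lt (by simpa using ha') hb'
  have hS0 : discShift a 0 = a := by simp [discShift]
  rcases eq_or_ne w 0 with h0 | h0
  · rw [← hwb, h0, hS0]
  exfalso
  have hp : 0 < ‖w‖ := norm_pos_iff.2 h0
  have he : ‖((‖w‖⁻¹ : ℝ) : ℂ) * w‖ = 1 := by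
    rw [norm_mul, Complex.norm_real, Real.norm_of_nonneg (inv_nonneg.2 hp.le),
      inv_mul_cancel₀ hp.ne']
  have h1 := hψ.radial_le hδ.le he ⟨hp.le, hw1⟩
  have h2 : (‖w‖ : ℂ) * (((‖w‖⁻¹ : ℝ) : ℂ) * w) = w := by
    rw [← mul_assoc, ← Complex.ofReal_mul, mul_inv_cancel₀ hp.ne']; simp
  rw [h2, hwb, hS0, hφa, hφb] at h1
  simp only [zero_mul, zero_div, mul_zero, Complex.zero_re, zero_add] at h1
  have := Real.log_neg (by linarith : 0 < 1 - ‖w‖) (by linarith)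
  nlinarith

theorem deriv_ne_zero (h : IsContractingField δ φ) (hδ : 0 < δ) {a : ℂ}
    (ha : a ∈ ball (0 : ℂ) 1) (hφa : φ a = 0) : deriv φ a ≠ 0 := by
  intro h0
  have := h.2 a ha
  rw [h0, hφa] at this
  simp only [mul_zero, Complex.zero_re, zero_mul, add_zero] at this
  nlinarith [one_sub_sq_pos ha]

theorem convex_comb {φ₀ φ₁ : ℂ → ℂ} (h₀ : IsContractingField δ φ₀) (h₁ : IsContractingField δ φ₁)
    {t : ℝ} (ht : t ∈ Icc (0 : ℝ) 1) :
    IsContractingField δ (fun z => φ₀ z + t * (φ₁ z - φ₀ z)) := by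
  refine ⟨h₀.1.add ((h₁.1.sub h₀.1).const_mul _), fun z hz => ?_⟩
  have d0 := (h₀.1.differentiableAt (isOpen_ball.mem_nhds hz)).hasDerivAt
  have d1 := (h₁.1.differentiableAt (isOpen_ball.mem_nhds hz)).hasDerivAt
  have hd : HasDerivAt (fun z => φ₀ z + t * (φ₁ z - φ₀ z)) _ z :=
    d0.add ((d1.sub d0).const_mul (t : ℂ))
  rw [hd.deriv]
  have e1 : (deriv φ₀ z + t * (deriv φ₁ z - deriv φ₀ z)).re
      = (1 - t) * (deriv φ₀ z).re + t * (deriv φ₁ z).re := by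
    rw [Complex.add_re, Complex.re_ofReal_mul, Complex.sub_re]; ring
  have e2 : (conj z * (φ₀ z + t * (φ₁ z - φ₀ z))).re
      = (1 - t) * (conj z * φ₀ z).re + t * (conj z * φ₁ z).re := by
    rw [show conj z * (φ₀ z + t * (φ₁ z - φ₀ z))
      = conj z * φ₀ z + t * (conj z * φ₁ z - conj z * φ₀ z) by ring,
      Complex.add_re, Complex.re_ofReal_mul, Complex.sub_re]; ring
  rw [e1, e2]
  nlinarith [mul_le_mul_of_nonneg_left (h₀.2 z hz) (sub_nonneg.2 ht.2),
    mul_le_mul_of_nonneg_left (h₁.2 z hz) ht.1]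

end IsContractingField

/-! ### From left inverses to contracting fields. -/

/-- If `f + s • v` stays in `D` for `s ∈ [0, 1]`, then the derivative of a left inverse of `f` in
the direction `v` generates a semigroup of holomorphic self-maps of the disc. -/
theorem generator_inequality {E : Type*} [NormedAddCommGroup E] [NormedSpace ℂ E]
    {D : Set E} (hD : IsOpen D) {G : E → ℂ} (hG : DifferentiableOn ℂ G D)
    (hGb : MapsTo G D (ball 0 1)) {f v : ℂ → E}
    (hf : DifferentiableOn ℂ f (ball 0 1)) (hfD : MapsTo f (ball 0 1) D)
    (hGf : ∀ x ∈ ball (0 : ℂ) 1, G (f x) = x) (hv : DifferentiableOn ℂ v (ball 0 1))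
    (hseg : ∀ s ∈ Ioo (0 : ℝ) 1, ∀ x ∈ ball (0 : ℂ) 1, f x + (s : ℂ) • v x ∈ D)
    {z : ℂ} (hz : z ∈ ball (0 : ℂ) 1) :
    (deriv (fun x => fderiv ℂ G (f x) (v x)) z).re * (1 - ‖z‖ ^ 2)
      + 2 * (conj z * fderiv ℂ G (f z) (v z)).re ≤ 0 := by
  obtain ⟨V, hV, hzV, -, hd, hlim⟩ :=
    exists_tendstoUniformlyOn_slope hD hG hGb isOpen_ball hf hfD hv hz
  have hof : Tendsto (fun s : ℝ => (s : ℂ)) (𝓝[>] 0) (𝓝[≠] 0) := by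
    refine tendsto_nhdsWithin_iff.2 ⟨?_, ?_⟩
    · exact (by simpa using Complex.continuous_ofReal.tendsto 0 :
        Tendsto (fun s : ℝ => (s : ℂ)) (𝓝 0) (𝓝 0)).mono_left nhdsWithin_le_nhds
    · filter_upwards [self_mem_nhdsWithin] with s hs
      simpa using (ne_of_gt hs : s ≠ 0)
  -- Locally uniform convergence of holomorphic functions carries the derivatives along, so both
  -- terms pass to the limit as real `s ↓ 0`.
  have h1 := ((hlim.tendstoLocallyUniformlyOn.deriv hd hV).tendsto_at hzV).comp hof
  have h2 := (hlim.tendsto_at hzV).comp hof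
  have h3 := ((Complex.continuous_re.tendsto _).comp h1).mul_const (1 - ‖z‖ ^ 2)
  have h4 := ((Complex.continuous_re.tendsto _).comp (h2.const_mul (conj z))).const_mul 2
  refine le_of_tendsto (h3.add h4) ?_
  have hIoo : Ioo (0 : ℝ) 1 ∈ 𝓝[>] (0 : ℝ) := Ioo_mem_nhdsGT one_pos
  filter_upwards [hIoo] with s hs
  simp only [Function.comp_apply]
  have hs0 : (s : ℂ) ≠ 0 := by exact_mod_cast hs.1.ne'
  set g : ℂ → ℂ := fun x => G (f x + (s : ℂ) • v x) with hg
  have hgd : DifferentiableOn ℂ g (ball 0 1) :=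
    hG.comp (hf.add (hv.const_smul _)) fun x hx => hseg s hs x hx
  have hgm : MapsTo g (ball 0 1) (ball 0 1) := fun x hx => hGb (hseg s hs x hx)
  have hpick := (mul_le_mul_of_nonneg_right (Complex.re_le_norm (deriv g z))
    (IsContractingField.one_sub_sq_pos hz).le).trans (norm_deriv_mul_le_one_sub_sq hgd hgm hz)
  have e1 : deriv (fun x => (s : ℂ)⁻¹ * (G (f x + (s : ℂ) • v x) - G (f x))) z
      = (s : ℂ)⁻¹ * (deriv g z - 1) := by
    have : (fun x => (s : ℂ)⁻¹ * (G (f x + (s : ℂ) • v x) - G (f x)))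
        =ᶠ[𝓝 z] fun x => (s : ℂ)⁻¹ * (g x - x) := by
      filter_upwards [isOpen_ball.mem_nhds hz] with x hx
      rw [hGf x hx]
    rw [this.deriv_eq]
    exact (((hgd.differentiableAt (isOpen_ball.mem_nhds hz)).hasDerivAt.sub
      (hasDerivAt_id z)).const_mul _).deriv
  rw [e1, hGf z hz]
  change ((s : ℂ)⁻¹ * (deriv g z - 1)).re * (1 - ‖z‖ ^ 2) +
    2 * (conj z * ((s : ℂ)⁻¹ * (g z - z))).re ≤ 0
  have e2 : ((s : ℂ)⁻¹ * (deriv g z - 1)).re = s⁻¹ * ((deriv g z).re - 1) := by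
    rw [← Complex.ofReal_inv, Complex.re_ofReal_mul]; simp
  have e3 : (conj z * ((s : ℂ)⁻¹ * (g z - z))).re = s⁻¹ * (conj z * (g z - z)).re := by
    rw [← Complex.ofReal_inv, mul_left_comm, Complex.re_ofReal_mul]
  rw [e2, e3]
  -- In Schwarz-Pick the second-order term `‖g z - z‖²` has the favourable sign and is dropped.
  have e4 : ‖g z‖ ^ 2 = ‖z‖ ^ 2 + 2 * (conj z * (g z - z)).re + ‖g z - z‖ ^ 2 := by
    simp only [← Complex.normSq_eq_norm_sq, Complex.normSq_apply, Complex.mul_re, Complex.sub_re,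
      Complex.sub_im, Complex.conj_re, Complex.conj_im]
    ring
  have e5 : ((deriv g z).re - 1) * (1 - ‖z‖ ^ 2) + 2 * (conj z * (g z - z)).re ≤ 0 := by
    nlinarith [sq_nonneg ‖g z - z‖]
  have := mul_nonpos_of_nonneg_of_nonpos (inv_nonneg.2 hs.1.le) e5
  linarith

theorem exists_add_smul_sub_mem {E : Type*} [NormedAddCommGroup E] [NormedSpace ℂ E]
    {D : Set E} (hD : IsOpen D) (hb : Bornology.IsBounded D) {z : E} (hz : z ∈ D) :
    ∃ δ : ℝ, 0 < δ ∧ ∀ x ∈ D, ∀ y ∈ D, z + (δ : ℂ) • (x - y) ∈ D := by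
  obtain ⟨r, hr, hrD⟩ := Metric.isOpen_iff.1 hD z hz
  obtain ⟨M, hM⟩ := Metric.isBounded_iff.1 hb
  have hM0 : 0 ≤ M := dist_nonneg.trans (hM hz hz)
  refine ⟨r / (M + 1), by positivity, fun x hx y hy => hrD ?_⟩
  rw [mem_ball, dist_eq_norm, add_sub_cancel_left, norm_smul, Complex.norm_real,
    Real.norm_of_nonneg (by positivity), ← dist_eq_norm]
  calc r / (M + 1) * dist x y ≤ r / (M + 1) * M := by gcongr; exact hM hx hy
    _ < r := by
      rw [div_mul_eq_mul_div, div_lt_iff₀ (by positivity)]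
      nlinarith

/-- In finite dimension, holomorphy of a family of functionals can be tested on each fixed vector.
-/
theorem differentiableOn_fderiv_comp {E : Type*} [NormedAddCommGroup E] [NormedSpace ℂ E]
    [FiniteDimensional ℂ E] {D : Set E} (hD : IsOpen D) {G : E → ℂ} (hG : DifferentiableOn ℂ G D)
    (hGb : MapsTo G D (ball 0 1)) {f : ℂ → E} {U : Set ℂ} (hU : IsOpen U)
    (hf : DifferentiableOn ℂ f U) (hfD : MapsTo f U D) :
    DifferentiableOn ℂ (fun x => fderiv ℂ G (f x)) U :=
  ((contDiffOn_clm_apply (n := 1)).2 fun y =>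
    (differentiableOn_fderiv_apply hD hG hGb hU hf hfD
      (differentiableOn_const y)).contDiffOn hU).differentiableOn one_ne_zero

section GeodesicField

variable {n : ℕ} {D : Set (EuclideanSpace ℂ (Fin n))} {f : ℂ → EuclideanSpace ℂ (Fin n)}
  {G : EuclideanSpace ℂ (Fin n) → ℂ}

theorem IsHolLeftInverse.fderiv_apply_deriv (hG : IsHolLeftInverse D f G) (hD : IsOpen D)
    (hf : DifferentiableOn ℂ f (ball 0 1)) (hfD : MapsTo f (ball 0 1) D)
    {z : ℂ} (hz : z ∈ ball (0 : ℂ) 1) : fderiv ℂ G (f z) (deriv f z) = 1 := by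
  have h1 := (hG.1.differentiableAt (hD.mem_nhds (hfD hz))).hasFDerivAt
  have h2 := h1.comp_hasDerivAt z (hf.differentiableAt (isOpen_ball.mem_nhds hz)).hasDerivAt
  have h3 : HasDerivAt (G ∘ f) 1 z := (hasDerivAt_id z).congr_of_eventuallyEq <| by
    filter_upwards [isOpen_ball.mem_nhds hz] with x hx using hG.2.2 x hx
  exact h2.unique h3

/-- The gain `δ` comes from perturbing the direction `z - f x` by `δ (f x - f ζ)`. This vanishes at
`x = ζ`, but there it adds `δ G'(f ζ) f'(ζ) = δ` to the derivative. -/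
theorem IsHolLeftInverse.isContractingField (hG : IsHolLeftInverse D f G) (hD : IsOpen D)
    (hconv : Convex ℝ D) (hf : DifferentiableOn ℂ f (ball 0 1)) (hfD : MapsTo f (ball 0 1) D)
    {z : EuclideanSpace ℂ (Fin n)} {δ : ℝ}
    (hδ : ∀ x ∈ D, ∀ y ∈ D, z + (δ : ℂ) • (x - y) ∈ D) :
    IsContractingField δ (fun ζ => fderiv ℂ G (f ζ) (z - f ζ)) := by
  have hA := differentiableOn_fderiv_comp hD hG.1 hG.2.1 isOpen_ball hf hfD
  have hφ : DifferentiableOn ℂ (fun ζ => fderiv ℂ G (f ζ) (z - f ζ)) (ball 0 1) :=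
    hA.clm_apply (hf.const_sub z)
  refine ⟨hφ, fun ζ hζ => ?_⟩
  set v : ℂ → EuclideanSpace ℂ (Fin n) := fun x => (z - f x) + (δ : ℂ) • (f x - f ζ) with hv
  have hvd : DifferentiableOn ℂ v (ball 0 1) := by
    fun_prop
  have hseg : ∀ s ∈ Ioo (0 : ℝ) 1, ∀ x ∈ ball (0 : ℂ) 1, f x + (s : ℂ) • v x ∈ D := by
    intro s hs x hx
    -- The point is `(1 - s) f x + s (z + δ (f x - f ζ))`, a convex combination of points of `D`.
    have := hconv (hfD hx) (hδ _ (hfD hx) _ (hfD hζ)) (sub_nonneg.2 hs.2.le) hs.1.le (by ring)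
    convert this using 1
    rw [← Complex.coe_smul, ← Complex.coe_smul, hv]
    push_cast
    module
  have hin := generator_inequality hD hG.1 hG.2.1 hf hfD hG.2.2 hvd hseg hζ
  have hfd := (hf.differentiableAt (isOpen_ball.mem_nhds hζ)).hasDerivAt
  have d1 : HasDerivAt (fun x => fderiv ℂ G (f x) (f x - f ζ)) 1 ζ := by
    have := (hA.differentiableAt (isOpen_ball.mem_nhds hζ)).hasDerivAt.clm_apply
      (hfd.sub_const (f ζ))
    refine this.congr_deriv ?_
    rw [hG.fderiv_apply_deriv hD hf hfD hζ, sub_self, map_zero, zero_add]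
  have d2 := (hφ.differentiableAt (isOpen_ball.mem_nhds hζ)).hasDerivAt
  have d3 : HasDerivAt (fun x => fderiv ℂ G (f x) (v x))
      (deriv (fun ζ => fderiv ℂ G (f ζ) (z - f ζ)) ζ + δ * 1) ζ := by
    refine (d2.add (d1.const_mul (δ : ℂ))).congr_of_eventuallyEq (Eventually.of_forall fun x => ?_)
    simp [hv]
  have e : v ζ = z - f ζ := by simp [hv]
  rw [d3.deriv, e, Complex.add_re, mul_one, Complex.ofReal_re] at hin
  linarith

end GeodesicField

/-! ### Dependence of the zero on the parameters. -/

/-- The implicit function theorem for a scalar holomorphic equation. -/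
theorem exists_implicit_solution {X : Type*} [NormedAddCommGroup X] [NormedSpace ℂ X]
    [CompleteSpace X] {F : X × ℂ → ℂ} {x₀ : X} {ζ₀ : ℂ} (hF : ContDiffAt ℂ 1 F (x₀, ζ₀))
    (h0 : F (x₀, ζ₀) = 0) (hd : deriv (fun ζ => F (x₀, ζ)) ζ₀ ≠ 0) :
    ∃ ψ : X → ℂ, ψ x₀ = ζ₀ ∧ DifferentiableAt ℂ ψ x₀ ∧ ∀ᶠ x in 𝓝 x₀, F (x, ψ x) = 0 := by
  have hs : HasStrictFDerivAt F (fderiv ℂ F (x₀, ζ₀)) (x₀, ζ₀) := hF.hasStrictFDerivAt one_ne_zero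
  have hval : fderiv ℂ F (x₀, ζ₀) (0, 1) = deriv (fun ζ => F (x₀, ζ)) ζ₀ := by
    have h1 : HasDerivAt (fun ζ : ℂ => (x₀, ζ)) ((0 : X), (1 : ℂ)) ζ₀ :=
      (hasDerivAt_const ζ₀ x₀).prodMk (hasDerivAt_id ζ₀)
    exact (hs.hasFDerivAt.comp_hasDerivAt ζ₀ h1).deriv.symm
  have hinv : (fderiv ℂ F (x₀, ζ₀) ∘L .inr ℂ X ℂ).IsInvertible := by
    refine ⟨ContinuousLinearEquiv.unitsEquivAut ℂ (Units.mk0 _ hd), ?_⟩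
    ext
    simp [← hval]
  refine ⟨hs.implicitFunctionOfProdDomain hinv, ?_, ?_, ?_⟩
  · exact (hs.eventually_apply_eq_iff_implicitFunctionOfProdDomain hinv).self_of_nhds.1 rfl
  · exact (hs.hasStrictFDerivAt_implicitFunctionOfProdDomain hinv).hasFDerivAt.differentiableAt
  · filter_upwards [hs.eventually_apply_implicitFunctionOfProdDomain hinv] with x hx
    rw [hx, h0]

section Homotopy

variable {E : Type*} [NormedAddCommGroup E] [NormedSpace ℂ E] {A₀ A₁ : ℂ → E →L[ℂ] ℂ}
  {f : ℂ → E} {D : Set E} {H : ℝ → E → ℂ}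

/-- The affine homotopy between two families of functionals along `f`, applied to `z - f ζ`. -/
noncomputable def pencil (A₀ A₁ : ℂ → E →L[ℂ] ℂ) (f : ℂ → E) (p : (ℂ × E) × ℂ) : ℂ :=
  (A₀ p.2 + p.1.1 • (A₁ p.2 - A₀ p.2)) (p.1.2 - f p.2)

theorem contDiffAt_pencil (h₀ : DifferentiableOn ℂ A₀ (ball 0 1))
    (h₁ : DifferentiableOn ℂ A₁ (ball 0 1)) (hf : DifferentiableOn ℂ f (ball 0 1))
    [CompleteSpace E] {p : (ℂ × E) × ℂ} (hp : p.2 ∈ ball (0 : ℂ) 1) :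
    ContDiffAt ℂ 1 (pencil A₀ A₁ f) p := by
  have hn := isOpen_ball.mem_nhds hp
  have c0 : ContDiffAt ℂ 1 (fun q : (ℂ × E) × ℂ => A₀ q.2) p :=
    ((h₀.contDiffOn isOpen_ball).contDiffAt hn).comp p contDiffAt_snd
  have c1 : ContDiffAt ℂ 1 (fun q : (ℂ × E) × ℂ => A₁ q.2) p :=
    ((h₁.contDiffOn isOpen_ball).contDiffAt hn).comp p contDiffAt_snd
  have cf : ContDiffAt ℂ 1 (fun q : (ℂ × E) × ℂ => f q.2) p :=
    ((hf.contDiffOn isOpen_ball).contDiffAt hn).comp p contDiffAt_snd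
  have ct : ContDiffAt ℂ 1 (fun q : (ℂ × E) × ℂ => q.1.1) p := contDiffAt_fst.fst
  have cz : ContDiffAt ℂ 1 (fun q : (ℂ × E) × ℂ => q.1.2) p := contDiffAt_fst.snd
  exact (c0.add (ct.smul (c1.sub c0))).clm_apply (cz.sub cf)

/-- Near `(t, z)`, the unique zero of the pencil is a holomorphic function of the parameters. -/
theorem exists_local_zero_function (h₀ : DifferentiableOn ℂ A₀ (ball 0 1))
    (h₁ : DifferentiableOn ℂ A₁ (ball 0 1)) (hf : DifferentiableOn ℂ f (ball 0 1))
    [CompleteSpace E]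
    (hder : ∀ t ∈ Icc (0 : ℝ) 1, ∀ z ∈ D,
      deriv (fun ζ => pencil A₀ A₁ f ((↑t, z), ζ)) (H t z) ≠ 0)
    (hH : ∀ t ∈ Icc (0 : ℝ) 1, ∀ z ∈ D, H t z ∈ ball (0 : ℂ) 1 ∧ ∀ ζ ∈ ball (0 : ℂ) 1,
      pencil A₀ A₁ f ((↑t, z), ζ) = 0 ↔ ζ = H t z)
    {t : ℝ} (ht : t ∈ Icc (0 : ℝ) 1) {z : E} (hz : z ∈ D) :
    ∃ ψ : ℂ × E → ℂ, ψ (t, z) = H t z ∧ DifferentiableAt ℂ ψ (t, z) ∧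
      ∀ᶠ x in 𝓝 ((t : ℂ), z), ∀ s ∈ Icc (0 : ℝ) 1, x.1 = (s : ℂ) → x.2 ∈ D → ψ x = H s x.2 := by
  obtain ⟨hmem, huniq⟩ := hH t ht z hz
  obtain ⟨ψ, hψ0, hψd, hψ⟩ := exists_implicit_solution
    (contDiffAt_pencil h₀ h₁ hf (p := ((t, z), H t z)) hmem) ((huniq _ hmem).2 rfl)
    (hder t ht z hz)
  refine ⟨ψ, hψ0, hψd, ?_⟩
  -- Uniqueness of the zero holds only inside the disc, so `ψ` must be kept there.
  have hball := hψd.continuousAt.eventually_mem (isOpen_ball.mem_nhds (hψ0 ▸ hmem))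
  filter_upwards [hψ, hball] with x hx hxb s hs hxs hxD
  refine ((hH s hs x.2 hxD).2 _ hxb).1 ?_
  rwa [← hxs]

theorem differentiableOn_zero_function (h₀ : DifferentiableOn ℂ A₀ (ball 0 1))
    (h₁ : DifferentiableOn ℂ A₁ (ball 0 1)) (hf : DifferentiableOn ℂ f (ball 0 1))
    [CompleteSpace E] (hD : IsOpen D)
    (hder : ∀ t ∈ Icc (0 : ℝ) 1, ∀ z ∈ D,
      deriv (fun ζ => pencil A₀ A₁ f ((↑t, z), ζ)) (H t z) ≠ 0)
    (hH : ∀ t ∈ Icc (0 : ℝ) 1, ∀ z ∈ D, H t z ∈ ball (0 : ℂ) 1 ∧ ∀ ζ ∈ ball (0 : ℂ) 1,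
      pencil A₀ A₁ f ((↑t, z), ζ) = 0 ↔ ζ = H t z)
    {t : ℝ} (ht : t ∈ Icc (0 : ℝ) 1) : DifferentiableOn ℂ (H t) D := by
  intro z hz
  obtain ⟨ψ, -, hψd, hψ⟩ := exists_local_zero_function h₀ h₁ hf hder hH ht hz
  have hd : DifferentiableAt ℂ (fun w : E => ((t : ℂ), w)) z :=
    (differentiableAt_const _).prodMk differentiableAt_id
  have hcomp : DifferentiableAt ℂ (fun w => ψ ((t : ℂ), w)) z :=
    DifferentiableAt.comp (g := ψ) z hψd hd
  refine (hcomp.congr_of_eventuallyEq ?_).differentiableWithinAt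
  filter_upwards [hd.continuousAt.tendsto.eventually hψ, hD.mem_nhds hz] with w hw hwD
  exact (hw t ht rfl hwD).symm

/-- The parameter `t` is complex in `pencil`, so one holomorphic implicit function covers `(t, z)`
jointly; restriction to real `t` gives the continuity. -/
theorem continuousOn_zero_function (h₀ : DifferentiableOn ℂ A₀ (ball 0 1))
    (h₁ : DifferentiableOn ℂ A₁ (ball 0 1)) (hf : DifferentiableOn ℂ f (ball 0 1))
    [CompleteSpace E]
    (hder : ∀ t ∈ Icc (0 : ℝ) 1, ∀ z ∈ D,
      deriv (fun ζ => pencil A₀ A₁ f ((↑t, z), ζ)) (H t z) ≠ 0)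
    (hH : ∀ t ∈ Icc (0 : ℝ) 1, ∀ z ∈ D, H t z ∈ ball (0 : ℂ) 1 ∧ ∀ ζ ∈ ball (0 : ℂ) 1,
      pencil A₀ A₁ f ((↑t, z), ζ) = 0 ↔ ζ = H t z) :
    ContinuousOn (fun p : ℝ × E => H p.1 p.2) (Icc (0 : ℝ) 1 ×ˢ D) := by
  rintro ⟨t, z⟩ ⟨ht, hz⟩
  obtain ⟨ψ, hψ0, hψd, hψ⟩ := exists_local_zero_function h₀ h₁ hf hder hH ht hz
  have hc : ContinuousAt (fun p : ℝ × E => ((p.1 : ℂ), p.2)) (t, z) := by fun_prop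
  have hcomp : ContinuousAt (fun p : ℝ × E => ψ ((p.1 : ℂ), p.2)) (t, z) :=
    ContinuousAt.comp (x := (t, z)) (g := ψ) hψd.continuousAt hc
  refine hcomp.continuousWithinAt.congr_of_eventuallyEq ?_ hψ0.symm
  filter_upwards [mem_nhdsWithin_of_mem_nhds (hc.tendsto.eventually hψ), self_mem_nhdsWithin]
    with p hp hpD
  exact (hp p.1 hpD.1 rfl hpD.2).symm

end Homotopy

/-! ### Construction of the homotopy and the case of Lempert left inverses. -/

section Lempert

variable {n : ℕ} {D : Set (EuclideanSpace ℂ (Fin n))} {f : ℂ → EuclideanSpace ℂ (Fin n)}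

theorem IsHolLeftInverse.exists_lempertHomotopy {G₀ G₁ : EuclideanSpace ℂ (Fin n) → ℂ}
    (hG₀ : IsHolLeftInverse D f G₀) (hG₁ : IsHolLeftInverse D f G₁) (hD : IsOpen D)
    (hconv : Convex ℝ D) (hbdd : Bornology.IsBounded D) (hf : DifferentiableOn ℂ f (ball 0 1))
    (hfD : MapsTo f (ball 0 1) D) :
    ∃ H : ℝ → EuclideanSpace ℂ (Fin n) → ℂ, IsLempertHomotopy D f H ∧
      CorrespondsTo D f G₀ (H 0) ∧ CorrespondsTo D f G₁ (H 1) := by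
  set A₀ := fun ζ => fderiv ℂ G₀ (f ζ) with hA₀
  set A₁ := fun ζ => fderiv ℂ G₁ (f ζ) with hA₁
  have d₀ : DifferentiableOn ℂ A₀ (ball 0 1) :=
    differentiableOn_fderiv_comp hD hG₀.1 hG₀.2.1 isOpen_ball hf hfD
  have d₁ : DifferentiableOn ℂ A₁ (ball 0 1) :=
    differentiableOn_fderiv_comp hD hG₁.1 hG₁.2.1 isOpen_ball hf hfD
  have hP : ∀ t ∈ Icc (0 : ℝ) 1, ∀ z ∈ D, ∃ δ, 0 < δ ∧
      IsContractingField δ (fun ζ => pencil A₀ A₁ f ((↑t, z), ζ)) := by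
    intro t ht z hz
    obtain ⟨δ, hδ, hmem⟩ := exists_add_smul_sub_mem hD hbdd hz
    refine ⟨δ, hδ, ?_⟩
    have := (hG₀.isContractingField hD hconv hf hfD hmem).convex_comb
      (hG₁.isContractingField hD hconv hf hfD hmem) ht
    simpa [pencil, hA₀, hA₁] using this
  have hex : ∀ t z, ∃ ζ₀ : ℂ, t ∈ Icc (0 : ℝ) 1 → z ∈ D → ζ₀ ∈ ball (0 : ℂ) 1 ∧
      ∀ ζ ∈ ball (0 : ℂ) 1, pencil A₀ A₁ f ((↑t, z), ζ) = 0 ↔ ζ = ζ₀ := by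
    intro t z
    by_cases h : t ∈ Icc (0 : ℝ) 1 ∧ z ∈ D
    · obtain ⟨δ, hδ, hc⟩ := hP t h.1 z h.2
      obtain ⟨ζ₀, hζ₀, h0⟩ := hc.exists_zero hδ
      exact ⟨ζ₀, fun _ _ => ⟨hζ₀, fun ζ hζ =>
        ⟨fun hz => hc.eq_of_zero hδ hζ₀ hζ h0 hz, fun hz => hz ▸ h0⟩⟩⟩
    -- Outside `[0, 1] × D` the value is irrelevant.
    · exact ⟨0, fun h1 h2 => absurd ⟨h1, h2⟩ h⟩
  choose H hH' using hex
  have hH : ∀ t ∈ Icc (0 : ℝ) 1, ∀ z ∈ D, H t z ∈ ball (0 : ℂ) 1 ∧ ∀ ζ ∈ ball (0 : ℂ) 1,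
      pencil A₀ A₁ f ((↑t, z), ζ) = 0 ↔ ζ = H t z := fun t ht z hz => hH' t z ht hz
  have hder : ∀ t ∈ Icc (0 : ℝ) 1, ∀ z ∈ D,
      deriv (fun ζ => pencil A₀ A₁ f ((↑t, z), ζ)) (H t z) ≠ 0 := by
    intro t ht z hz
    obtain ⟨δ, hδ, hc⟩ := hP t ht z hz
    obtain ⟨hm, hu⟩ := hH t ht z hz
    exact hc.deriv_ne_zero hδ hm ((hu _ hm).2 rfl)
  refine ⟨H, ⟨fun t ht => ⟨⟨?_, fun z hz => (hH t ht z hz).1, fun ζ hζ => ?_⟩, fun ζ hζ => ?_⟩,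
    continuousOn_zero_function d₀ d₁ hf hder hH⟩, fun z hz => ?_, fun z hz => ?_⟩
  · exact differentiableOn_zero_function d₀ d₁ hf hD hder hH ht
  · exact (((hH t ht _ (hfD hζ)).2 ζ hζ).1 (by simp [pencil])).symm
  · refine ⟨_, ⟨A₀ ζ + (t : ℂ) • (A₁ ζ - A₀ ζ), (A₀ ζ + (t : ℂ) • (A₁ ζ - A₀ ζ)) (f ζ), ?_, rfl⟩, ?_⟩
    · intro h0
      -- Both derivatives send `f' ζ` to `1`, hence so does every affine combination, which is
      -- therefore nonzero.
      have := congrArg (fun l : EuclideanSpace ℂ (Fin n) →L[ℂ] ℂ => l (deriv f ζ)) h0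
      simp [hA₀, hA₁, hG₀.fderiv_apply_deriv hD hf hfD hζ,
        hG₁.fderiv_apply_deriv hD hf hfD hζ] at this
    · ext z
      simp only [mem_ofPred_eq, mem_inter_iff]
      rw [and_comm (a := z ∈ D)]
      refine and_congr_left fun hz => ?_
      rw [eq_comm, ← (hH t ht z hz).2 ζ hζ, pencil, map_sub, sub_eq_zero]
  · refine ⟨(hH 0 (by simp) z hz).1, fun ζ hζ => ?_⟩
    rw [← (hH 0 (by simp) z hz).2 ζ hζ]
    simp [pencil, hA₀]
  · refine ⟨(hH 1 (by simp) z hz).1, fun ζ hζ => ?_⟩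
    rw [← (hH 1 (by simp) z hz).2 ζ hζ]
    simp [pencil, hA₁]

/-- The only left inverse corresponding to a Lempert left inverse is itself. -/
theorem CorrespondsTo.eqOn_of_isLempertLeftInverse {L H : EuclideanSpace ℂ (Fin n) → ℂ}
    (hLH : CorrespondsTo D f L H) (hL : IsLempertLeftInverse D f L) (hD : IsOpen D)
    (hfD : MapsTo f (ball 0 1) D) : EqOn H L D := by
  intro z hz
  have hζ : L z ∈ ball (0 : ℂ) 1 := hL.1.2.1 hz
  refine (((hLH z hz).2 (L z) hζ).1 ?_).symm
  obtain ⟨A, ⟨l, c, -, rfl⟩, hA⟩ := hL.2 (L z) hζ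
  have hmem : ∀ w ∈ D, L w = L z ↔ l w = c := fun w hw => by
    have := Set.ext_iff.1 hA w
    simpa [hw] using this
  have hlz : l z = c := (hmem z hz).1 rfl
  have hlf : l (f (L z)) = c := (hmem _ (hfD hζ)).1 (hL.1.2.2 _ hζ)
  -- The functional `l` is constant on the complex line through `f (L z)` and `z`, so `L` is
  -- constant on this line near `f (L z)` and its derivative there kills `v`.
  set v := z - f (L z) with hv
  have hd1 : HasDerivAt (fun s : ℂ => f (L z) + s • v) v 0 := by
    simpa using ((hasDerivAt_id (0 : ℂ)).smul_const v).const_add (f (L z))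
  have hd2 : HasFDerivAt L (fderiv ℂ L (f (L z))) (f (L z) + (0 : ℂ) • v) := by
    rw [zero_smul, add_zero]
    exact (hL.1.1.differentiableAt (hD.mem_nhds (hfD hζ))).hasFDerivAt
  have hd3 := hd2.comp_hasDerivAt (0 : ℂ) hd1
  refine hd3.unique ((hasDerivAt_const (0 : ℂ) (L z)).congr_of_eventuallyEq ?_)
  have hev : ∀ᶠ s : ℂ in 𝓝 0, f (L z) + s • v ∈ D :=
    hd1.continuousAt.eventually_mem (hD.mem_nhds (by simpa using hfD hζ))
  filter_upwards [hev] with s hs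
  refine (hmem _ hs).2 ?_
  simp [hv, hlz, hlf]

end Lempert

end LempertInverses

theorem theorem2p3 (n : ℕ) (D : Set (EuclideanSpace ℂ (Fin n))) (hDopen : IsOpen D)
    (hDconv : Convex ℝ D) (hDbdd : Bornology.IsBounded D)
    (f : ℂ → EuclideanSpace ℂ (Fin n)) (hf : IsComplexGeodesic D f) :
    (∀ G₀ G₁ : EuclideanSpace ℂ (Fin n) → ℂ,
      IsHolLeftInverse D f G₀ → IsHolLeftInverse D f G₁ →
      ∃ H : ℝ → EuclideanSpace ℂ (Fin n) → ℂ, IsLempertHomotopy D f H ∧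
        CorrespondsTo D f G₀ (H 0) ∧ CorrespondsTo D f G₁ (H 1)) ∧
    (∀ L₀ L₁ : EuclideanSpace ℂ (Fin n) → ℂ,
      IsLempertLeftInverse D f L₀ → IsLempertLeftInverse D f L₁ →
      ∃ H : ℝ → EuclideanSpace ℂ (Fin n) → ℂ, IsLempertHomotopy D f H ∧
        Set.EqOn (H 0) L₀ D ∧ Set.EqOn (H 1) L₁ D) := by
  obtain ⟨hfd, hfD, -⟩ := hf
  refine ⟨fun G₀ G₁ h₀ h₁ => h₀.exists_lempertHomotopy h₁ hDopen hDconv hDbdd hfd hfD,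
    fun L₀ L₁ h₀ h₁ => ?_⟩
  obtain ⟨H, hH, c₀, c₁⟩ := h₀.1.exists_lempertHomotopy h₁.1 hDopen hDconv hDbdd hfd hfD
  exact ⟨H, hH, c₀.eqOn_of_isLempertLeftInverse h₀ hDopen hfD,
    c₁.eqOn_of_isLempertLeftInverse h₁ hDopen hfD⟩
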